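/- Let $d\ge 3$, and let $\overline B(c_n,r_n)$ be a countable (finite or infinite) collection of closed balls in $\mathbb R^d$ with positive radii $r_n$, which are non-overlapping (their interiors are pairwise disjoint; in particular, this holds if the closed balls are pairwise disjoint). Assume that $$\Omega=\mathbb R^d\setminus\bigcup_n \overline B(c_n,r_n)$$ is a region, that is, a connected open set, and that $0\in\Omega$. If $$\sum_n\left(\frac{r_n}{|c_n|}\right)^{d-2}<\infty,$$ then the collection of balls is avoidable: if $(B_t)_{t\ge 0}$ is a standard Brownian motion in $\mathbb R^d$ starting from $0$ (that is, its coordinates are independent one-dimensional standard Brownian motions starting from $0$ with almost surely continuous paths), then with positive probability $B_t$ does not lie in any of the balls for any $t\ge 0$. -/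

import Mathlib

open MeasureTheory ProbabilityTheory
open scoped NNReal

/-- A process `B` with values in `ℝ^d` is a (standard) Brownian motion started at `0` under `P` if
its coordinates are independent real Brownian motions started at `0`. -/
structure IsBrownianMotion {d : ℕ} {Ω : Type*} [MeasurableSpace Ω]
    (B : ℝ≥0 → Ω → EuclideanSpace ℝ (Fin d)) (P : Measure Ω) : Prop where
  isBrownianReal_coord : ∀ i : Fin d, IsBrownianReal (fun t ω ↦ B t ω i) P
  iIndepFun_coord : iIndepFun (fun (i : Fin d) (ω : Ω) (t : ℝ≥0) ↦ B t ω i) P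

/-- The complement in `ℝ^d` of the union of the closed balls with centres `c n` and radii `r n`. -/
def ballsComplement {d : ℕ} {ι : Type*} (c : ι → EuclideanSpace ℝ (Fin d)) (r : ι → ℝ) :
    Set (EuclideanSpace ℝ (Fin d)) :=
  (⋃ n, Metric.closedBall (c n) (r n))ᶜ

/-- A region is a nonempty connected open set (`IsConnected` includes being nonempty). -/
def IsRegion {d : ℕ} (U : Set (EuclideanSpace ℝ (Fin d))) : Prop :=
  IsOpen U ∧ IsConnected U

/-- The collection of closed balls with centres `c n` and radii `r n` is avoidable for the process
`B` if, with positive probability, `B` never hits any of the balls. -/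
def IsAvoidableFor {d : ℕ} {ι Ω : Type*} [MeasurableSpace Ω]
    (B : ℝ≥0 → Ω → EuclideanSpace ℝ (Fin d)) (P : Measure Ω)
    (c : ι → EuclideanSpace ℝ (Fin d)) (r : ι → ℝ) : Prop :=
  0 < P {ω | ∀ t : ℝ≥0, ∀ n : ι, B t ω ∉ Metric.closedBall (c n) (r n)}

/-! Write `G(ρ)` for the Green function `greenTail d 0 ρ`, a constant times `ρ^(2-d)`, finite for `ρ
> 0` because `d ≥ 3`. Since `G(‖x + W_t‖)` decreases in mean, Brownian motion from `x` enters the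
ball of radius `ρ` about `0` with probability at most `G(‖x‖) / G(ρ)` (`measure_hit_mul_le`).
Summing over the balls gives the bound `h(x) = ∑ G(‖x - c n‖) / G(2 r n)` for the probability of
hitting any of them, and the hypothesis on the radii says exactly that `h(0)` is finite.

This does not suffice, since `h(0)` may be at least `1`. However, the mean of `h(W_t)` is the part
after time `t` of a convergent time integral whose total is `h(0)`, so it is below `1` for large
`t`. Hence `{h < 1}` has positive volume (`volume_hittingBound_lt_one_ne_zero`), and its points
survive with positive probability.

Survival then spreads through the region to `0`. Over a short time the path is a straight segment
plus a small bridge independent of the future, so inside a ball in the region it can move to a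
survival set of positive volume without leaving the region (`ball_subset_survivalSet`).
Connectedness does the rest (`subset_survivalSet`). -/

/-! ### Heat kernel and Green function -/

/-- The heat kernel of `ℝ^d` at time `s`, as a function of the distance `ρ` to the origin. -/
noncomputable def heatKernel (d : ℕ) (s ρ : ℝ) : ENNReal :=
  ENNReal.ofReal ((√(2 * Real.pi * s))⁻¹ ^ d * Real.exp (-ρ ^ 2 / (2 * s)))

/-- The part of the Green function of `ℝ^d` that comes from the times after `t`, as a function of
the distance `ρ` to the origin. -/
noncomputable def greenTail (d : ℕ) (t ρ : ℝ) : ENNReal :=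
  ∫⁻ s in Set.Ioi t, heatKernel d s ρ

lemma measurable_heatKernel (d : ℕ) : Measurable (fun p : ℝ × ℝ ↦ heatKernel d p.1 p.2) := by
  unfold heatKernel
  fun_prop

lemma heatKernel_pos (d : ℕ) {s : ℝ} (hs : 0 < s) (ρ : ℝ) : 0 < heatKernel d s ρ :=
  ENNReal.ofReal_pos.2 (by positivity)

lemma measurable_greenTail (d : ℕ) (t : ℝ) : Measurable (greenTail d t) := by
  unfold greenTail
  exact Measurable.lintegral_prod_right' (f := fun p : ℝ × ℝ ↦ heatKernel d p.2 p.1)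
    ((measurable_heatKernel d).comp measurable_swap)

lemma heatKernel_anti (d : ℕ) {s : ℝ} (hs : 0 < s) {ρ ρ' : ℝ} (h0 : 0 ≤ ρ) (h : ρ ≤ ρ') :
    heatKernel d s ρ' ≤ heatKernel d s ρ := by
  unfold heatKernel
  gcongr

lemma greenTail_anti (d : ℕ) {t : ℝ} (ht : 0 ≤ t) {ρ ρ' : ℝ} (h0 : 0 ≤ ρ) (h : ρ ≤ ρ') :
    greenTail d t ρ' ≤ greenTail d t ρ :=
  setLIntegral_mono' measurableSet_Ioi fun _ hs ↦ heatKernel_anti d (ht.trans_lt hs) h0 h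

lemma greenTail_le (d : ℕ) {t : ℝ} (ht : 0 ≤ t) (ρ : ℝ) :
    greenTail d t ρ ≤ greenTail d 0 ρ :=
  lintegral_mono_set (Set.Ioi_subset_Ioi ht)

lemma heatKernel_scale (d : ℕ) {s ρ : ℝ} (hρ : 0 < ρ) :
    heatKernel d (ρ ^ 2 * s) ρ = ENNReal.ofReal (ρ⁻¹ ^ d) * heatKernel d s 1 := by
  unfold heatKernel
  rw [← ENNReal.ofReal_mul (by positivity), ← mul_assoc (ρ⁻¹ ^ d), ← mul_pow, ← mul_inv]
  congr 2
  · congr 2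
    rw [show 2 * Real.pi * (ρ ^ 2 * s) = ρ ^ 2 * (2 * Real.pi * s) by ring,
      Real.sqrt_mul (by positivity), Real.sqrt_sq hρ.le]
  · congr 1
    rcases eq_or_ne s 0 with rfl | hs
    · simp
    · field_simp

/-- Substitute `s = ρ ^ 2 * u` in the time integral; the value of the constant at `ρ = 1` is never
needed. -/
lemma greenTail_zero_scale {d : ℕ} (hd : 2 ≤ d) {ρ : ℝ} (hρ : 0 < ρ) :
    greenTail d 0 ρ = ENNReal.ofReal (ρ⁻¹ ^ (d - 2)) * greenTail d 0 1 := by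
  have himg : (fun u : ℝ ↦ ρ ^ 2 * u) '' Set.Ioi 0 = Set.Ioi 0 := by
    rw [Set.image_mul_left_Ioi (by positivity), mul_zero]
  have h := lintegral_image_eq_lintegral_abs_deriv_mul (s := Set.Ioi (0 : ℝ)) measurableSet_Ioi
    (f := fun u ↦ ρ ^ 2 * u) (f' := fun _ ↦ ρ ^ 2)
    (fun x _ ↦ by simpa using ((hasDerivAt_id x).const_mul (ρ ^ 2)).hasDerivWithinAt)
    (fun a _ b _ hab ↦ by simpa [hρ.ne'] using hab) (fun s ↦ heatKernel d s ρ)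
  rw [himg] at h
  unfold greenTail
  rw [h, ← lintegral_const_mul]
  · refine lintegral_congr fun s ↦ ?_
    rw [heatKernel_scale d hρ, ← mul_assoc, ← ENNReal.ofReal_mul (by positivity)]
    congr 2
    rw [abs_of_nonneg (by positivity), ← Nat.sub_add_cancel hd, pow_add]
    simp only [Nat.add_sub_cancel]
    field_simp
  · exact (measurable_heatKernel d).comp (measurable_id.prodMk measurable_const)

lemma greenTail_zero_one_pos (d : ℕ) : greenTail d 0 1 ≠ 0 := by
  unfold greenTail
  have hm : Measurable fun s ↦ heatKernel d s 1 :=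
    (measurable_heatKernel d).comp (measurable_id.prodMk measurable_const)
  rw [Ne, lintegral_eq_zero_iff hm]
  intro h
  have h2 := (ae_restrict_iff' measurableSet_Ioi).1 h
  have h3 : ∀ᵐ s : ℝ, s ∉ Set.Ioi (0 : ℝ) := by
    filter_upwards [h2] with s hs h0
    exact (heatKernel_pos d h0 1).ne' (hs h0)
  have := measure_eq_zero_iff_ae_notMem.2 h3
  simp at this

/-- At small times the exponential beats every power of `s`; at large times the integrand is at most
`s ^ (-3/2)`, which is where `d ≥ 3` enters. -/
lemma greenTail_zero_one_lt_top {d : ℕ} (hd : 3 ≤ d) : greenTail d 0 1 < ⊤ := by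
  unfold greenTail
  rw [← Set.Ioc_union_Ioi_eq_Ioi (zero_le_one' ℝ)]
  refine (lintegral_union_le _ _ _).trans_lt (ENNReal.add_lt_top.2 ⟨?_, ?_⟩)
  · have hb : ∀ s ∈ Set.Ioc (0 : ℝ) 1, heatKernel d s 1 ≤ ENNReal.ofReal (d.factorial * 2 ^ d) := by
      intro s hs
      apply ENNReal.ofReal_le_ofReal
      have h1 : (1 / (2 * s)) ^ d / d.factorial ≤ Real.exp (1 / (2 * s)) :=
        Real.pow_div_factorial_le_exp _ (by have := hs.1; positivity) d
      have hs0 := hs.1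
      have h2 : s ≤ √(2 * Real.pi * s) := by
        apply Real.le_sqrt_of_sq_le
        nlinarith [hs.2, Real.pi_gt_three]
      have h3 : (√(2 * Real.pi * s))⁻¹ ^ d ≤ s⁻¹ ^ d := by gcongr
      have h4 : Real.exp (-1 ^ 2 / (2 * s)) ≤ d.factorial * (2 * s) ^ d := by
        rw [show -1 ^ 2 / (2 * s) = -(1 / (2 * s)) by ring, Real.exp_neg]
        rw [inv_le_comm₀ (Real.exp_pos _) (by positivity)]
        refine le_trans (le_of_eq ?_) h1
        rw [div_pow, one_pow]
        field_simp
      calc _ ≤ s⁻¹ ^ d * (d.factorial * (2 * s) ^ d) := by gcongr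
        _ = d.factorial * 2 ^ d := by
          rw [mul_pow, inv_pow]
          field_simp
    calc _ ≤ ∫⁻ s in Set.Ioc (0 : ℝ) 1, ENNReal.ofReal (d.factorial * 2 ^ d) :=
          setLIntegral_mono' measurableSet_Ioc hb
      _ < ⊤ := by
        rw [setLIntegral_const]
        exact ENNReal.mul_lt_top ENNReal.ofReal_lt_top (by simp)
  · have hb : ∀ s ∈ Set.Ioi (1 : ℝ), heatKernel d s 1 ≤ ENNReal.ofReal (s ^ (-(3 / 2) : ℝ)) := by
      intro s hs
      apply ENNReal.ofReal_le_ofReal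
      have hs1 : (1 : ℝ) < s := hs
      have hs0 : 0 < s := by linarith
      have h2 : √s ≤ √(2 * Real.pi * s) := by
        apply Real.sqrt_le_sqrt
        nlinarith [Real.pi_gt_three]
      have h5 : 1 ≤ √s := Real.one_le_sqrt.2 hs1.le
      have h3 : (√(2 * Real.pi * s))⁻¹ ^ d ≤ (√s)⁻¹ ^ d := by gcongr
      have h4 : (√s)⁻¹ ^ d ≤ (√s)⁻¹ ^ 3 :=
        pow_le_pow_of_le_one (by positivity) (inv_le_one_of_one_le₀ h5) hd
      have h6 : Real.exp (-1 ^ 2 / (2 * s)) ≤ 1 := by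
        rw [Real.exp_le_one_iff]
        apply div_nonpos_of_nonpos_of_nonneg <;> [norm_num; positivity]
      have h7 : (√s)⁻¹ ^ 3 = s ^ (-(3 / 2) : ℝ) := by
        rw [Real.sqrt_eq_rpow, ← Real.rpow_neg hs0.le, ← Real.rpow_natCast, ← Real.rpow_mul hs0.le]
        norm_num
      calc _ ≤ (√s)⁻¹ ^ 3 * 1 := by gcongr; exact h3.trans h4
        _ = _ := by rw [mul_one, h7]
    calc _ ≤ ∫⁻ s in Set.Ioi (1 : ℝ), ENNReal.ofReal (s ^ (-(3 / 2) : ℝ)) :=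
          setLIntegral_mono' measurableSet_Ioi hb
      _ < ⊤ := by
        have := (integrableOn_Ioi_rpow_of_lt (a := -(3 / 2)) (by norm_num) (zero_lt_one' ℝ)).2
        refine lt_of_le_of_lt (lintegral_mono fun s ↦ ?_) this
        exact Real.ofReal_le_enorm _

/-- Chapman–Kolmogorov equation for the heat kernel. -/
lemma lintegral_heatKernel_mul_heatKernel (d : ℕ) {s t : ℝ} (hs : 0 < s) (ht : 0 < t)
    (x : EuclideanSpace ℝ (Fin d)) :
    ∫⁻ y : EuclideanSpace ℝ (Fin d), heatKernel d s ‖x + y‖ * heatKernel d t ‖y‖ =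
      heatKernel d (s + t) ‖x‖ := by
  -- Completing the square: the product is a Gaussian in `y` centred at `-(t / (s + t)) • x`, with
  -- `b = 1/(2s) + 1/(2t)`.
  set b : ℝ := (s + t) / (2 * s * t) with hb
  have hb0 : 0 < b := by positivity
  set C : ℝ := (√(2 * Real.pi * s))⁻¹ ^ d * (√(2 * Real.pi * t))⁻¹ ^ d *
    Real.exp (-‖x‖ ^ 2 / (2 * (s + t))) with hC
  have h1 : ∀ y : EuclideanSpace ℝ (Fin d), heatKernel d s ‖x + y‖ * heatKernel d t ‖y‖ =
      ENNReal.ofReal (C * Real.exp (-b * ‖y + (t / (s + t)) • x‖ ^ 2)) := by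
    intro y
    unfold heatKernel
    rw [← ENNReal.ofReal_mul (by positivity)]
    congr 1
    rw [hC, mul_mul_mul_comm, mul_assoc _ (Real.exp _), ← Real.exp_add, ← Real.exp_add]
    congr 2
    rw [norm_add_sq_real, norm_add_sq_real, norm_smul, inner_smul_right, real_inner_comm,
      Real.norm_of_nonneg (by positivity), hb]
    field_simp
    ring
  simp_rw [h1]
  rw [lintegral_add_right_eq_self
    (fun y : EuclideanSpace ℝ (Fin d) ↦ ENNReal.ofReal (C * Real.exp (-b * ‖y‖ ^ 2)))]
  have h2 := GaussianFourier.integral_rexp_neg_mul_sq_norm (V := EuclideanSpace ℝ (Fin d)) hb0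
  have h3 : Integrable (fun y : EuclideanSpace ℝ (Fin d) ↦ Real.exp (-b * ‖y‖ ^ 2)) := by
    -- A non-integrable function has integral `0` by convention, but the Gaussian integral is
    -- positive.
    by_contra h
    rw [integral_undef h] at h2
    exact (Real.rpow_pos_of_pos (by positivity) _).ne h2
  rw [← ofReal_integral_eq_lintegral_ofReal (h3.const_mul C)
    (.of_forall fun y ↦ by positivity), integral_const_mul, h2]
  unfold heatKernel
  congr 1
  rw [finrank_euclideanSpace_fin, hC, mul_right_comm]
  congr 1
  have h4 : (Real.pi / b) ^ ((d : ℝ) / 2) = √(Real.pi / b) ^ d := by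
    rw [Real.sqrt_eq_rpow, ← Real.rpow_natCast, ← Real.rpow_mul (by positivity)]
    congr 1
    ring
  rw [h4, ← mul_pow, ← mul_pow]
  congr 1
  rw [← Real.sqrt_inv, ← Real.sqrt_inv, ← Real.sqrt_inv, ← Real.sqrt_mul (by positivity),
    ← Real.sqrt_mul (by positivity)]
  congr 1
  rw [hb]
  field_simp

/-- The heat semigroup cuts off the Green function at small times. -/
lemma lintegral_greenTail_mul_heatKernel (d : ℕ) {t : ℝ} (ht : 0 < t)
    (x : EuclideanSpace ℝ (Fin d)) :
    ∫⁻ y : EuclideanSpace ℝ (Fin d), greenTail d 0 ‖x + y‖ * heatKernel d t ‖y‖ =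
      greenTail d t ‖x‖ := by
  have hm := measurable_heatKernel d
  have h1 : ∀ y : EuclideanSpace ℝ (Fin d), greenTail d 0 ‖x + y‖ * heatKernel d t ‖y‖ =
      ∫⁻ s in Set.Ioi 0, heatKernel d s ‖x + y‖ * heatKernel d t ‖y‖ := by
    intro y
    rw [greenTail, lintegral_mul_const]
    exact hm.comp (measurable_id.prodMk measurable_const)
  simp_rw [h1]
  rw [lintegral_lintegral_swap]
  -- By Chapman–Kolmogorov the integrand becomes the kernel at time `s + t`; translating time by `t`
  -- turns `(0, ∞)` into `(t, ∞)`.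
  · rw [setLIntegral_congr_fun measurableSet_Ioi
      (fun s hs ↦ lintegral_heatKernel_mul_heatKernel d hs ht x), greenTail,
      ← lintegral_indicator measurableSet_Ioi, ← lintegral_indicator measurableSet_Ioi,
      ← lintegral_add_right_eq_self ((Set.Ioi t).indicator _) t]
    refine lintegral_congr fun s ↦ ?_
    simp [Set.indicator_apply]
  · refine (Measurable.mul (f := fun p : EuclideanSpace ℝ (Fin d) × ℝ ↦ heatKernel d p.2 ‖x + p.1‖)
      (g := fun p ↦ heatKernel d t ‖p.1‖) ?_ ?_).aemeasurable
    · exact hm.comp (measurable_snd.prodMk (measurable_const.add measurable_fst).norm)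
    · exact hm.comp (measurable_const.prodMk measurable_fst.norm)

/-! ### Product laws and Gaussian densities -/

/-- Families that are independent within each coordinate, with independent coordinates, are
independent. -/
lemma indepFun_pi_of_iIndepFun_prodMk {Ω ι α β : Type*} [MeasurableSpace Ω] [MeasurableSpace α]
    [MeasurableSpace β] [Fintype ι] {P : Measure Ω} {F : ι → Ω → α} {G : ι → Ω → β}
    (hF : ∀ i, Measurable (F i)) (hG : ∀ i, Measurable (G i))
    (h : iIndepFun (fun i ω ↦ (F i ω, G i ω)) P) (h2 : ∀ i, IndepFun (F i) (G i) P) :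
    IndepFun (fun ω i ↦ F i ω) (fun ω i ↦ G i ω) P := by
  have := h.isProbabilityMeasure
  have _ i : IsProbabilityMeasure (P.map (F i)) :=
    Measure.isProbabilityMeasure_map (hF i).aemeasurable
  have _ i : IsProbabilityMeasure (P.map (G i)) :=
    Measure.isProbabilityMeasure_map (hG i).aemeasurable
  have hFi : iIndepFun F P := h.comp (fun _ ↦ Prod.fst) fun _ ↦ measurable_fst
  have hGi : iIndepFun G P := h.comp (fun _ ↦ Prod.snd) fun _ ↦ measurable_snd
  rw [indepFun_iff_map_prod_eq_prod_map_map (measurable_pi_lambda _ hF).aemeasurable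
    (measurable_pi_lambda _ hG).aemeasurable,
    (iIndepFun_iff_map_fun_eq_pi_map fun i ↦ (hF i).aemeasurable).1 hFi,
    (iIndepFun_iff_map_fun_eq_pi_map fun i ↦ (hG i).aemeasurable).1 hGi,
    ← (measurePreserving_arrowProdEquivProdArrow α β ι (fun i ↦ P.map (F i))
      (fun i ↦ P.map (G i))).map_eq]
  have h3 := (iIndepFun_iff_map_fun_eq_pi_map
    fun i ↦ ((hF i).prodMk (hG i)).aemeasurable).1 h
  have h4 : (fun i ↦ P.map (fun ω ↦ (F i ω, G i ω))) = fun i ↦ (P.map (F i)).prod (P.map (G i)) :=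
    funext fun i ↦ (indepFun_iff_map_prod_eq_prod_map_map (hF i).aemeasurable
      (hG i).aemeasurable).1 (h2 i)
  rw [← h4, ← h3, Measure.map_map (MeasurableEquiv.measurable _) (by fun_prop)]
  rfl

/-- A product of measures with densities with respect to Lebesgue measure has the product
density. -/
lemma pi_withDensity_ofReal {d : ℕ} {f : Fin d → ℝ → ℝ} (hf : ∀ i, Integrable (f i))
    (h0 : ∀ i x, 0 ≤ f i x) :
    Measure.pi (fun i ↦ (volume : Measure ℝ).withDensity fun x ↦ ENNReal.ofReal (f i x)) =
      (volume : Measure (Fin d → ℝ)).withDensity fun x ↦ ENNReal.ofReal (∏ i, f i (x i)) := by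
  have _ i : IsFiniteMeasure ((volume : Measure ℝ).withDensity fun x ↦ ENNReal.ofReal (f i x)) :=
    isFiniteMeasure_withDensity_ofReal (hf i).2
  refine Measure.pi_eq fun s hs ↦ ?_
  rw [withDensity_apply _ (MeasurableSet.univ_pi hs), volume_pi, Measure.restrict_pi_pi,
    ← ofReal_integral_eq_lintegral_ofReal, integral_fintype_prod_eq_prod,
    ENNReal.ofReal_prod_of_nonneg]
  · refine Finset.prod_congr rfl fun i _ ↦ ?_
    rw [withDensity_apply _ (hs i), ofReal_integral_eq_lintegral_ofReal (hf i).integrableOn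
      (.of_forall (h0 i))]
  · exact fun i _ ↦ integral_nonneg (h0 i)
  · exact Integrable.fintype_prod (fun i ↦ (hf i).integrableOn)
  · exact .of_forall fun x ↦ Finset.prod_nonneg fun i _ ↦ h0 i _

/-- The centred Gaussian measure with covariance `t • 1` has the heat kernel as its density. -/
lemma map_pi_gaussianReal (d : ℕ) {t : ℝ≥0} (ht : 0 < t) :
    (Measure.pi fun _ : Fin d ↦ gaussianReal 0 t).map (WithLp.toLp 2) =
      (volume : Measure (EuclideanSpace ℝ (Fin d))).withDensity fun x ↦ heatKernel d t ‖x‖ := by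
  simp_rw [gaussianReal_of_var_ne_zero 0 ht.ne', gaussianPDF_def]
  rw [pi_withDensity_ofReal (fun _ ↦ integrable_gaussianPDFReal _ _)
    (fun _ ↦ gaussianPDFReal_nonneg _ _)]
  have hk : Measurable fun x : EuclideanSpace ℝ (Fin d) ↦ heatKernel d t ‖x‖ :=
    (measurable_heatKernel d).comp (measurable_const.prodMk measurable_norm)
  have hmp := PiLp.volume_preserving_toLp (Fin d)
  refine Measure.ext fun s hs ↦ ?_
  rw [Measure.map_apply hmp.measurable hs, withDensity_apply _ (hmp.measurable hs),
    withDensity_apply _ hs, ← hmp.setLIntegral_comp_preimage hs hk]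
  refine lintegral_congr fun x ↦ ?_
  unfold heatKernel gaussianPDFReal
  rw [Finset.prod_mul_distrib, ← Real.exp_sum, Finset.prod_const, Finset.card_univ,
    Fintype.card_fin, ← Finset.sum_div]
  congr 4
  rw [EuclideanSpace.norm_sq_eq]
  simp

/-! ### Brownian motion with continuous paths: increments and bridges -/

/-- A Brownian motion started at `0`, all of whose paths are continuous. -/
structure IsContinuousBM {d : ℕ} {Ω : Type*} [MeasurableSpace Ω]
    (W : ℝ≥0 → Ω → EuclideanSpace ℝ (Fin d)) (P : Measure Ω) : Prop where
  coord : ∀ i : Fin d, IsPreBrownianReal (fun t ω ↦ W t ω i) P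
  indep : iIndepFun (fun (i : Fin d) (ω : Ω) (t : ℝ≥0) ↦ W t ω i) P
  meas : ∀ t, Measurable (W t)
  cont : ∀ ω, Continuous (W · ω)
  zero : ∀ ω, W 0 ω = 0

section

variable {d : ℕ} {Ω : Type*} [MeasurableSpace Ω] {P : Measure Ω}
  {W : ℝ≥0 → Ω → EuclideanSpace ℝ (Fin d)}

lemma measurable_of_measurable_on_dense {E : Type*} [NormedAddCommGroup E] [MeasurableSpace E]
    [BorelSpace E] {X : ℝ≥0 → Ω → E} (hc : ∀ ω, Continuous (X · ω))
    (hm : ∀ n, Measurable (X (TopologicalSpace.denseSeq ℝ≥0 n))) (t : ℝ≥0) :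
    Measurable (X t) := by
  have h := TopologicalSpace.denseRange_denseSeq ℝ≥0 t
  rw [mem_closure_iff_seq_limit] at h
  obtain ⟨u, hu, hut⟩ := h
  refine measurable_of_tendsto_metrizable (f := fun n ↦ X (u n)) (fun n ↦ ?_) ?_
  · obtain ⟨k, hk⟩ := hu n
    rw [← hk]
    exact hm k
  · exact tendsto_pi_nhds.2 fun ω ↦ ((hc ω).tendsto t).comp hut

/-- A Brownian motion is indistinguishable from one with continuous paths. -/
lemma IsBrownianMotion.exists_isContinuousBM {B : ℝ≥0 → Ω → EuclideanSpace ℝ (Fin d)}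
    (hB : IsBrownianMotion B P) :
    ∃ W : ℝ≥0 → Ω → EuclideanSpace ℝ (Fin d), IsContinuousBM W P ∧
      ∀ᵐ ω ∂P, ∀ t, B t ω = W t ω := by
  have hae : ∀ t, AEMeasurable (B t) P := fun t ↦ by
    have h : AEMeasurable (fun ω i ↦ B t ω i) P :=
      aemeasurable_pi_lambda _ fun i ↦ (hB.isBrownianReal_coord i).aemeasurable t
    exact (PiLp.continuous_toLp 2 (fun _ : Fin d ↦ ℝ)).measurable.comp_aemeasurable h
  have hgood : ∀ᵐ ω ∂P, Continuous (B · ω) ∧ B 0 ω = 0 ∧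
      ∀ n, B (TopologicalSpace.denseSeq ℝ≥0 n) ω =
        (hae (TopologicalSpace.denseSeq ℝ≥0 n)).mk _ ω := by
    filter_upwards [ae_all_iff.2 fun i ↦ (hB.isBrownianReal_coord i).cont,
      ae_all_iff.2 fun i ↦ (hB.isBrownianReal_coord i).eval_zero_ae_eq_zero,
      ae_all_iff.2 fun n ↦ (hae (TopologicalSpace.denseSeq ℝ≥0 n)).ae_eq_mk] with ω h1 h2 h3
    refine ⟨?_, ?_, h3⟩
    · exact (PiLp.continuous_toLp 2 (fun _ : Fin d ↦ ℝ)).comp (continuous_pi h1)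
    · ext i
      exact h2 i
  obtain ⟨N, hN, hNm, hNP⟩ := exists_measurable_superset_of_null (ae_iff.1 hgood)
  set A : Set Ω := Nᶜ
  have hA : ∀ ω ∈ A, _ := fun ω hω ↦ not_not.1 (Set.notMem_subset hN hω)
  have hAm : MeasurableSet A := hNm.compl
  have hAP : ∀ᵐ ω ∂P, ω ∈ A := measure_eq_zero_iff_ae_notMem.1 hNP
  -- Setting `W` to `0` off the measurable full-measure set `A` makes continuity and the starting
  -- value hold for every `ω`.
  classical
  let W : ℝ≥0 → Ω → EuclideanSpace ℝ (Fin d) := fun t ω ↦ if ω ∈ A then B t ω else 0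
  have hBW : ∀ᵐ ω ∂P, ∀ t, B t ω = W t ω := by
    filter_upwards [hAP] with ω hω t
    simp [W, hω]
  have hc : ∀ ω, Continuous (W · ω) := fun ω ↦ by
    by_cases hω : ω ∈ A
    · simpa [W, hω] using (hA ω hω).1
    · simpa [W, hω] using continuous_const
  refine ⟨W, ⟨fun i ↦ ?_, ?_, measurable_of_measurable_on_dense hc fun n ↦ ?_, hc, fun ω ↦ ?_⟩, hBW⟩
  · refine (hB.isBrownianReal_coord i).toIsPreBrownianReal.congr fun t ↦ ?_
    filter_upwards [hBW] with ω hω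
    rw [hω]
  · refine hB.iIndepFun_coord.congr fun i ↦ ?_
    filter_upwards [hBW] with ω hω
    funext t
    rw [hω]
  · have : W (TopologicalSpace.denseSeq ℝ≥0 n) = fun ω ↦ if ω ∈ A then
        (hae (TopologicalSpace.denseSeq ℝ≥0 n)).mk _ ω else 0 := by
      funext ω
      by_cases hω : ω ∈ A
      · simp [W, hω, (hA ω hω).2.2 n]
      · simp [W, hω]
    rw [this]
    exact Measurable.ite hAm (hae _).measurable_mk measurable_const
  · by_cases hω : ω ∈ A
    · simp [W, hω, (hA ω hω).2.1]
    · simp [W, hω]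

namespace IsContinuousBM

lemma isProbabilityMeasure (hW : IsContinuousBM W P) : IsProbabilityMeasure P :=
  hW.indep.isProbabilityMeasure

lemma meas_coord (hW : IsContinuousBM W P) (t : ℝ≥0) (i : Fin d) :
    Measurable fun ω ↦ W t ω i :=
  (EuclideanSpace.proj (𝕜 := ℝ) i).continuous.measurable.comp (hW.meas t)

/-- The increments after a fixed time form a Brownian motion. -/
lemma shift (hW : IsContinuousBM W P) (τ : ℝ≥0) :
    IsContinuousBM (fun t ω ↦ W (τ + t) ω - W τ ω) P where
  coord i := (hW.coord i).shift τ
  indep := hW.indep.comp (fun _ f t ↦ f (τ + t) - f τ) fun _ ↦ by fun_prop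
  meas t := (hW.meas _).sub (hW.meas _)
  cont ω := by
    have := hW.cont ω
    fun_prop
  zero ω := by simp

/-- The law of a Brownian motion at a positive time has the heat kernel as its density. -/
lemma map_eq (hW : IsContinuousBM W P) {t : ℝ≥0} (ht : 0 < t) :
    P.map (W t) = volume.withDensity fun x ↦ heatKernel d t ‖x‖ := by
  have := hW.isProbabilityMeasure
  have h : iIndepFun (fun (i : Fin d) ω ↦ W t ω i) P :=
    hW.indep.comp (fun _ f ↦ f t) fun _ ↦ by fun_prop
  rw [iIndepFun_iff_map_fun_eq_pi_map fun i ↦ (hW.meas_coord t i).aemeasurable] at h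
  simp_rw [fun i ↦ ((hW.coord i).hasLaw_eval t).map_eq] at h
  rw [← map_pi_gaussianReal d ht, ← h, Measure.map_map (by fun_prop)
    (measurable_pi_lambda _ fun i ↦ hW.meas_coord t i)]
  rfl

lemma measurable_toLp_swap (S : Type*) :
    Measurable fun (f : Fin d → S → ℝ) (s : S) ↦
      (WithLp.toLp 2 fun i ↦ f i s : EuclideanSpace ℝ (Fin d)) := by
  refine measurable_pi_lambda _ fun s ↦ ?_
  exact (PiLp.continuous_toLp 2 (fun _ : Fin d ↦ ℝ)).measurable.comp
    (measurable_pi_lambda _ fun i ↦ (measurable_pi_apply s).comp (measurable_pi_apply i))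

/-- The increments after a fixed time are independent of the position at that time. -/
lemma indepFun_shift (hW : IsContinuousBM W P) (τ : ℝ≥0) :
    IndepFun (W τ) (fun ω t ↦ W (τ + t) ω - W τ ω) P := by
  have h := indepFun_pi_of_iIndepFun_prodMk (P := P) (F := fun (i : Fin d) ω ↦ W τ ω i)
    (G := fun i ω (t : ℝ≥0) ↦ W (τ + t) ω i - W τ ω i) (fun i ↦ hW.meas_coord τ i)
    (fun i ↦ measurable_pi_lambda _ fun t ↦ (hW.meas_coord _ i).sub (hW.meas_coord _ i))
    (hW.indep.comp (fun _ f ↦ (f τ, fun t ↦ f (τ + t) - f τ)) fun _ ↦ by fun_prop)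
    (fun i ↦ ((hW.coord i).indepFun_shift τ).symm.comp
      (φ := fun f : Set.Iic τ → ℝ ↦ f ⟨τ, Set.self_mem_Iic⟩) (measurable_pi_apply _) measurable_id)
  exact h.comp (PiLp.continuous_toLp 2 (fun _ : Fin d ↦ ℝ)).measurable (measurable_toLp_swap ℝ≥0)

/-- The Brownian bridge on `[0, τ]` is independent of the Brownian motion after time `τ`. -/
lemma indepFun_bridge (hW : IsContinuousBM W P) {τ : ℝ≥0} (hτ : 0 < τ) :
    IndepFun (fun ω (s : Set.Iic τ) ↦ W s ω - ((s : ℝ) / τ) • W τ ω)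
      (fun ω (t : Set.Ici τ) ↦ W t ω) P := by
  have := hW.isProbabilityMeasure
  have hbm : ∀ (i : Fin d) (s : ℝ≥0), Measurable fun ω ↦ W s ω i - ((s : ℝ) / τ) * W τ ω i :=
    fun i s ↦ (hW.meas_coord _ i).sub ((hW.meas_coord _ i).const_mul _)
  have hL2 : ∀ (i : Fin d) (s : ℝ≥0), MemLp (fun ω ↦ W s ω i) 2 P :=
    fun i s ↦ ((IsPreBrownianReal.isGaussianProcess (hW.coord i)).hasGaussianLaw_eval s).memLp_two
  have h := indepFun_pi_of_iIndepFun_prodMk (P := P)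
    (F := fun (i : Fin d) ω (s : Set.Iic τ) ↦ W s ω i - ((s : ℝ) / τ) * W τ ω i)
    (G := fun i ω (t : Set.Ici τ) ↦ W t ω i)
    (fun i ↦ measurable_pi_lambda _ fun s ↦ hbm i s)
    (fun i ↦ measurable_pi_lambda _ fun t ↦ hW.meas_coord _ i)
    (hW.indep.comp (fun _ f ↦ (fun s : Set.Iic τ ↦ f s - ((s : ℝ) / τ) * f τ,
      fun t : Set.Ici τ ↦ f t)) fun _ ↦ by fun_prop)
    (fun i ↦ by
      -- For jointly Gaussian families zero covariance suffices: for `s ≤ τ ≤ t` it is `s - (s / τ)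
      -- * τ = 0`.
      apply IsGaussianProcess.indepFun_of_covariance_eq_zero
      · apply IsGaussianProcess.of_isGaussianProcess
          (IsPreBrownianReal.isGaussianProcess (hW.coord i))
        rintro (⟨s, hs⟩ | ⟨t, ht⟩)
        · exact ⟨{τ, s},
            { toFun x := x ⟨s, by simp⟩ - ((s : ℝ) / τ) * x ⟨τ, by simp⟩
              map_add' x y := by simp; ring
              map_smul' c x := by simp; ring }, by simp⟩
        · exact ⟨{t},
            { toFun x := x ⟨t, by simp⟩
              map_add' x y := by simp
              map_smul' c x := by simp }, by simp⟩
      · exact fun s ↦ (hbm i s).aemeasurable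
      · exact fun t ↦ (hW.meas_coord _ i).aemeasurable
      · rintro ⟨s, hs : s ≤ τ⟩ ⟨t, ht : τ ≤ t⟩
        rw [covariance_fun_sub_left (hL2 i s) ((hL2 i τ).const_mul _) (hL2 i t),
          covariance_const_mul_left, (hW.coord i).covariance_fun_eval,
          (hW.coord i).covariance_fun_eval, min_eq_left (hs.trans ht), min_eq_left ht]
        have : (τ : ℝ) ≠ 0 := by exact_mod_cast hτ.ne'
        field_simp
        simp)
  exact h.comp (measurable_toLp_swap (Set.Iic τ)) (measurable_toLp_swap (Set.Ici τ))

end IsContinuousBM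

end

/-! ### Markov property and hitting probabilities -/

namespace IsContinuousBM

variable {d : ℕ} {Ω : Type*} [MeasurableSpace Ω] {P : Measure Ω}
  {W : ℝ≥0 → Ω → EuclideanSpace ℝ (Fin d)}

lemma measurable_measure_shift (hW : IsContinuousBM W P) (τ : ℝ≥0)
    {S : Set (EuclideanSpace ℝ (Fin d) × (ℝ≥0 → EuclideanSpace ℝ (Fin d)))}
    (hS : MeasurableSet S) :
    Measurable fun y ↦ P {ω | (y, fun t ↦ W (τ + t) ω - W τ ω) ∈ S} := by
  have := hW.isProbabilityMeasure
  have hZ : Measurable fun ω (s : ℝ≥0) ↦ W (τ + s) ω - W τ ω :=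
    measurable_pi_lambda _ fun s ↦ (hW.shift τ).meas s
  exact measurable_measure_prodMk_left ((measurable_fst.prodMk (hZ.comp measurable_snd)) hS)

/-- The Markov property at a fixed time. -/
lemma measure_markov (hW : IsContinuousBM W P) (τ : ℝ≥0)
    {S : Set (EuclideanSpace ℝ (Fin d) × (ℝ≥0 → EuclideanSpace ℝ (Fin d)))}
    (hS : MeasurableSet S) :
    P {ω | (W τ ω, fun t ↦ W (τ + t) ω - W τ ω) ∈ S} =
      ∫⁻ y, P {ω | (y, fun t ↦ W (τ + t) ω - W τ ω) ∈ S} ∂(P.map (W τ)) := by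
  have := hW.isProbabilityMeasure
  have hZ : Measurable fun ω (t : ℝ≥0) ↦ W (τ + t) ω - W τ ω :=
    measurable_pi_lambda _ fun t ↦ (hW.shift τ).meas t
  have h := (indepFun_iff_map_prod_eq_prod_map_map (hW.meas τ).aemeasurable
    hZ.aemeasurable).1 (hW.indepFun_shift τ)
  have h1 := Measure.map_apply ((hW.meas τ).prodMk hZ) hS (μ := P)
  rw [h, Measure.prod_apply hS] at h1
  refine h1.symm.trans (lintegral_congr fun y ↦ ?_)
  rw [Measure.map_apply hZ (measurable_prodMk_left hS)]
  rfl

/-- Superharmonicity of the Green function: averaging over `W τ` deletes the times before `τ` from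
its integral. -/
lemma lintegral_greenTail_le (hW : IsContinuousBM W P) (τ : ℝ≥0)
    (x : EuclideanSpace ℝ (Fin d)) :
    ∫⁻ y, greenTail d 0 ‖x + y‖ ∂(P.map (W τ)) ≤ greenTail d 0 ‖x‖ := by
  have := hW.isProbabilityMeasure
  have hm : Measurable fun y : EuclideanSpace ℝ (Fin d) ↦ greenTail d 0 ‖x + y‖ :=
    (measurable_greenTail d 0).comp (measurable_id.const_add x).norm
  rcases eq_or_ne τ 0 with rfl | hτ
  · rw [lintegral_map hm (hW.meas 0)]
    simp [hW.zero]
  · have hτ' : 0 < τ := pos_of_ne_zero hτ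
    have hk : Measurable fun y : EuclideanSpace ℝ (Fin d) ↦ heatKernel d τ ‖y‖ :=
      (measurable_heatKernel d).comp (measurable_const.prodMk measurable_norm)
    rw [hW.map_eq hτ', lintegral_withDensity_eq_lintegral_mul _ hk hm]
    refine le_trans (le_of_eq ?_) (greenTail_le d (t := τ) τ.2 ‖x‖)
    rw [← lintegral_greenTail_mul_heatKernel d (t := τ) (by exact_mod_cast hτ') x]
    exact lintegral_congr fun y ↦ mul_comm _ _

/-- Maximal inequality: a Brownian motion observed at finitely many times enters the ball of radius
`ρ` with probability at most the ratio of the values of the Green function. -/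
lemma measure_hit_finite_mul_le (ρ : ℝ) (n : ℕ) :
    ∀ {W : ℝ≥0 → Ω → EuclideanSpace ℝ (Fin d)}, IsContinuousBM W P →
      ∀ {t : ℕ → ℝ≥0}, Monotone t → ∀ x : EuclideanSpace ℝ (Fin d),
        P {ω | ∃ k < n, ‖x + W (t k) ω‖ ≤ ρ} * greenTail d 0 ρ ≤ greenTail d 0 ‖x‖ := by
  induction n with
  | zero => simp
  | succ n ih =>
    -- Condition on the first observation. If it lies in the ball, monotonicity of the Green
    -- function suffices; if not, induction applies to the motion restarted at `t 0`, which is why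
    -- `W` is generalized. Superharmonicity then averages the bounds.
    intro W hW t ht x
    have := hW.isProbabilityMeasure
    set S : Set (EuclideanSpace ℝ (Fin d) × (ℝ≥0 → EuclideanSpace ℝ (Fin d))) :=
      {p | ‖x + p.1‖ ≤ ρ} ∪ ⋃ k < n, {p | ‖x + p.1 + p.2 (t (k + 1) - t 0)‖ ≤ ρ} with hS
    have hSm : MeasurableSet S := by
      refine (measurableSet_le (by fun_prop) measurable_const).union
        (.biUnion (Set.to_countable _) fun k _ ↦ measurableSet_le ?_ measurable_const)
      exact ((measurable_fst.const_add x).add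
        ((measurable_pi_apply (t (k + 1) - t 0)).comp measurable_snd)).norm
    have h1 : {ω | ∃ k < n + 1, ‖x + W (t k) ω‖ ≤ ρ} =
        {ω | (W (t 0) ω, fun s ↦ W (t 0 + s) ω - W (t 0) ω) ∈ S} := by
      ext ω
      have hadd : ∀ k, t 0 + (t (k + 1) - t 0) = t (k + 1) :=
        fun k ↦ add_tsub_cancel_of_le (ht (Nat.zero_le _))
      simp only [hS, Set.mem_ofPred_eq, Set.mem_union, Set.mem_iUnion, exists_prop, hadd,
        Nat.exists_lt_succ_left, add_assoc, add_sub_cancel]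
    rw [h1, hW.measure_markov (t 0) hSm, ← lintegral_mul_const]
    · refine (lintegral_mono fun y ↦ ?_).trans (hW.lintegral_greenTail_le (t 0) x)
      by_cases hy : ‖x + y‖ ≤ ρ
      · calc _ ≤ 1 * greenTail d 0 ρ := by gcongr; exact prob_le_one
          _ ≤ _ := by
            rw [one_mul]
            exact greenTail_anti d le_rfl (norm_nonneg _) hy
      · refine le_trans (le_of_eq ?_) (ih (hW.shift (t 0)) (t := fun k ↦ t (k + 1) - t 0)
          (fun a b hab ↦ tsub_le_tsub_right (ht (by lia)) _) (x + y))
        simp [hS, hy]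
    · exact hW.measurable_measure_shift (t 0) hSm

/-- A Brownian motion enters the open ball of radius `ρ` with probability at most the ratio of the
values of the Green function. -/
lemma measure_hit_mul_le (hW : IsContinuousBM W P) (ρ : ℝ)
    (x : EuclideanSpace ℝ (Fin d)) :
    P {ω | ∃ t, ‖x + W t ω‖ < ρ} * greenTail d 0 ρ ≤ greenTail d 0 ‖x‖ := by
  have hmono : ∀ m : ℕ, Monotone fun k : ℕ ↦ (k : ℝ≥0) / 2 ^ m := fun m a b hab ↦ by
    dsimp only
    gcongr
  -- Dyadic times of mesh `2 ^ (-m)` on `[0, 2 ^ m)`, hence `4 ^ m` of them. An open condition that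
  -- holds at some time holds at a nearby grid time.
  set A : ℕ → Set Ω := fun m ↦ {ω | ∃ k : ℕ, k < 4 ^ m ∧ ‖x + W ((k : ℝ≥0) / 2 ^ m) ω‖ ≤ ρ} with hA
  have hAmono : Monotone A := by
    refine monotone_nat_of_le_succ fun m ω hω ↦ ?_
    obtain ⟨k, hk, hkω⟩ := hω
    refine ⟨2 * k, by rw [pow_succ]; lia, ?_⟩
    convert hkω using 4
    rw [pow_succ]
    push_cast
    field_simp
  have hsub : {ω | ∃ t, ‖x + W t ω‖ < ρ} ⊆ ⋃ m, A m := by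
    rintro ω ⟨t, ht⟩
    have hopen : IsOpen {s | ‖x + W s ω‖ < ρ} := by
      have := hW.cont ω
      exact isOpen_lt (by fun_prop) continuous_const
    have hlim : Filter.Tendsto (fun m : ℕ ↦ (⌊(t : ℝ) * 2 ^ m⌋₊ : ℝ≥0) / 2 ^ m)
        Filter.atTop (nhds t) := by
      rw [← NNReal.tendsto_coe]
      push_cast
      exact (tendsto_nat_floor_mul_div_atTop (R := ℝ) (a := t) t.2).comp
        (tendsto_pow_atTop_atTop_of_one_lt one_lt_two)
    have h2 : ∀ᶠ m : ℕ in Filter.atTop, t + 1 ≤ 2 ^ m :=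
      (tendsto_pow_atTop_atTop_of_one_lt (one_lt_two (α := ℝ≥0))).eventually_ge_atTop _
    obtain ⟨m, hm1, hm2⟩ := ((hlim.eventually (hopen.mem_nhds ht)).and h2).exists
    refine Set.mem_iUnion.2 ⟨m, ⌊(t : ℝ) * 2 ^ m⌋₊, ?_, le_of_lt hm1⟩
    rw [Nat.floor_lt (by positivity)]
    have h3 : (t : ℝ) < 2 ^ m := by
      exact_mod_cast lt_of_lt_of_le (lt_add_one t) hm2
    calc (t : ℝ) * 2 ^ m < 2 ^ m * 2 ^ m := by gcongr
      _ = ((4 ^ m : ℕ) : ℝ) := by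
        rw [← mul_pow]
        norm_num
  calc _ ≤ (⨆ m, P (A m)) * greenTail d 0 ρ := by
        rw [← hAmono.measure_iUnion]
        gcongr
    _ ≤ _ := by
      rw [ENNReal.iSup_mul]
      exact iSup_le fun m ↦ measure_hit_finite_mul_le ρ _ hW (hmono m) x

end IsContinuousBM

/-! ### Survival in an open set and its spread through a region -/

open TopologicalSpace in
/-- The paths that stay in `U`, with a positive distance to the complement on bounded time
intervals, as tested on a countable dense set of times. -/
def pathsStayingIn {E : Type*} [PseudoEMetricSpace E] (U : Set E) : Set (ℝ≥0 → E) :=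
  {w | ∀ N : ℕ, ∃ k : ℕ, ∀ n, denseSeq ℝ≥0 n < N → (k : ENNReal)⁻¹ ≤
    Metric.infEDist (w (denseSeq ℝ≥0 n)) Uᶜ}

lemma measurableSet_pathsStayingIn {E : Type*} [PseudoEMetricSpace E] [MeasurableSpace E]
    [BorelSpace E] (U : Set E) : MeasurableSet (pathsStayingIn U) := by
  unfold pathsStayingIn
  simp only [Set.ofPred_forall, Set.ofPred_exists]
  refine .iInter fun N ↦ .iUnion fun k ↦ .iInter fun n ↦ .iInter fun _ ↦ ?_
  exact measurableSet_le measurable_const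
    (Metric.continuous_infEDist.measurable.comp (measurable_pi_apply _))

/-- The uniform gap is what survives passage from dense times to all times; compactness of `[0, N]`
supplies it for a continuous path in `U`. -/
lemma mem_pathsStayingIn_iff {E : Type*} [PseudoEMetricSpace E] {U : Set E} (hU : IsOpen U)
    {w : ℝ≥0 → E} (hw : Continuous w) : w ∈ pathsStayingIn U ↔ ∀ t, w t ∈ U := by
  have hcont : Continuous fun t ↦ Metric.infEDist (w t) Uᶜ := Metric.continuous_infEDist.comp hw
  constructor
  · intro h t
    obtain ⟨N, hN⟩ := exists_nat_gt t
    obtain ⟨k, hk⟩ := h N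
    have hcl : IsClosed {s | (k : ENNReal)⁻¹ ≤ Metric.infEDist (w s) Uᶜ} :=
      isClosed_le continuous_const hcont
    have hmem : t ∈ closure (Set.Iio (N : ℝ≥0) ∩ Set.range (TopologicalSpace.denseSeq ℝ≥0)) :=
      (TopologicalSpace.denseRange_denseSeq ℝ≥0).open_subset_closure_inter isOpen_Iio hN
    have ht : (k : ENNReal)⁻¹ ≤ Metric.infEDist (w t) Uᶜ := by
      refine closure_minimal ?_ hcl hmem
      rintro _ ⟨hs, n, rfl⟩
      exact hk n hs
    by_contra hmemU
    rw [Metric.infEDist_zero_of_mem hmemU] at ht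
    simp at ht
  · intro h N
    obtain ⟨s, -, hs⟩ := (isCompact_Icc (a := (0 : ℝ≥0)) (b := N)).exists_isMinOn
      ⟨0, by simp⟩ hcont.continuousOn
    have hpos : Metric.infEDist (w s) Uᶜ ≠ 0 := fun h0 ↦
      (Metric.mem_iff_infEDist_zero_of_closed hU.isClosed_compl).2 h0 (h s)
    obtain ⟨k, hk⟩ := ENNReal.exists_inv_nat_lt hpos
    exact ⟨k, fun n hn ↦ hk.le.trans (hs ⟨zero_le, hn.le⟩)⟩

/-- The starting points from which every Brownian motion on the given probability space with
continuous paths stays in `U` forever with positive probability. -/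
def survivalSet {d : ℕ} {Ω : Type*} [MeasurableSpace Ω] (P : Measure Ω)
    (U : Set (EuclideanSpace ℝ (Fin d))) : Set (EuclideanSpace ℝ (Fin d)) :=
  {x | ∀ W : ℝ≥0 → Ω → EuclideanSpace ℝ (Fin d), IsContinuousBM W P →
    0 < P {ω | ∀ t, x + W t ω ∈ U}}

section

variable {d : ℕ} {Ω : Type*} [MeasurableSpace Ω] {P : Measure Ω}
  {W : ℝ≥0 → Ω → EuclideanSpace ℝ (Fin d)}

lemma measurable_heatKernel_norm (d : ℕ) (t : ℝ) :
    Measurable fun y : EuclideanSpace ℝ (Fin d) ↦ heatKernel d t ‖y‖ :=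
  (measurable_heatKernel d).comp (measurable_const.prodMk measurable_norm)

namespace IsContinuousBM

lemma volume_absolutelyContinuous (hW : IsContinuousBM W P) {t : ℝ≥0} (ht : 0 < t) :
    volume ≪ P.map (W t) := by
  rw [hW.map_eq ht]
  exact withDensity_absolutelyContinuous' (measurable_heatKernel_norm d t).aemeasurable
    (.of_forall fun x ↦ (heatKernel_pos d (by exact_mod_cast ht) _).ne')

/-- By continuity at time `0`, these events for `τ = 1 / (n + 1)` cover the whole space, so they
cannot all be null. -/
lemma exists_measure_small_ne_zero (hW : IsContinuousBM W P) {ε : ℝ} (hε : 0 < ε) :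
    ∃ τ : ℝ≥0, 0 < τ ∧ P {ω | ∀ s ≤ τ, ‖W s ω‖ ≤ ε} ≠ 0 := by
  have := hW.isProbabilityMeasure
  by_contra! h
  have h1 : P (⋃ n : ℕ, {ω | ∀ s ≤ ((n : ℝ≥0) + 1)⁻¹, ‖W s ω‖ ≤ ε}) = 0 :=
    measure_iUnion_null fun n ↦ h _ (by positivity)
  have h2 : ⋃ n : ℕ, {ω | ∀ s ≤ ((n : ℝ≥0) + 1)⁻¹, ‖W s ω‖ ≤ ε} = Set.univ := by
    refine Set.eq_univ_of_forall fun ω ↦ ?_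
    have h3 : ∀ᶠ s in nhds (0 : ℝ≥0), ‖W s ω‖ < ε := by
      have := hW.cont ω
      refine (isOpen_lt (by fun_prop) continuous_const).mem_nhds ?_
      simpa [hW.zero] using hε
    rw [NNReal.nhds_zero_basis.eventually_iff] at h3
    obtain ⟨δ, hδ, hs⟩ := h3
    obtain ⟨n, hn⟩ := exists_nat_one_div_lt hδ
    rw [one_div] at hn
    exact Set.mem_iUnion.2 ⟨n, fun s hsn ↦ (hs (hsn.trans_lt hn)).le⟩
  rw [h2] at h1
  simp at h1

/-- Shortly after the start, the bridge part of a Brownian motion is small with positive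
probability, independently of the future after that time. -/
lemma exists_bridge (hW : IsContinuousBM W P) {ε : ℝ} (hε : 0 < ε) :
    ∃ τ : ℝ≥0, 0 < τ ∧
      ∀ S : Set (EuclideanSpace ℝ (Fin d) × (ℝ≥0 → EuclideanSpace ℝ (Fin d))), MeasurableSet S →
        P {ω | (W τ ω, fun t ↦ W (τ + t) ω - W τ ω) ∈ S} ≠ 0 →
        P {ω | (∀ s ≤ τ, ‖W s ω - ((s : ℝ) / τ) • W τ ω‖ ≤ ε) ∧
          (W τ ω, fun t ↦ W (τ + t) ω - W τ ω) ∈ S} ≠ 0 := by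
  obtain ⟨τ, hτ, hP⟩ := hW.exists_measure_small_ne_zero (half_pos hε)
  refine ⟨τ, hτ, fun S hS hPS ↦ ?_⟩
  have : Nonempty (Set.Iic τ) := ⟨⟨τ, Set.self_mem_Iic⟩⟩
  set T : Set (Set.Iic τ → EuclideanSpace ℝ (Fin d)) :=
    {f | ∀ n, ‖f (TopologicalSpace.denseSeq (Set.Iic τ) n)‖ ≤ ε} with hT
  have hTm : MeasurableSet T := by
    rw [hT, Set.ofPred_forall]
    exact .iInter fun n ↦ measurableSet_le (measurable_pi_apply _).norm measurable_const
  have hTω : ∀ ω, (fun s : Set.Iic τ ↦ W s ω - ((s : ℝ) / τ) • W τ ω) ∈ T ↔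
      ∀ s ≤ τ, ‖W s ω - ((s : ℝ) / τ) • W τ ω‖ ≤ ε := by
    intro ω
    constructor
    · intro h s hs
      have hc := hW.cont ω
      exact (TopologicalSpace.denseRange_denseSeq (Set.Iic τ)).induction_on
        (p := fun s ↦ ‖W s ω - ((s : ℝ) / τ) • W τ ω‖ ≤ ε) ⟨s, hs⟩
        (isClosed_le (by fun_prop) continuous_const) h
    · exact fun h n ↦ h _ (TopologicalSpace.denseSeq (Set.Iic τ) n).2
  let φ : (Set.Ici τ → EuclideanSpace ℝ (Fin d)) →
      EuclideanSpace ℝ (Fin d) × (ℝ≥0 → EuclideanSpace ℝ (Fin d)) :=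
    fun f ↦ (f ⟨τ, Set.self_mem_Ici⟩,
      fun t ↦ f ⟨τ + t, Set.mem_Ici.2 le_self_add⟩ - f ⟨τ, Set.self_mem_Ici⟩)
  have hφ : Measurable φ := by fun_prop
  have h1 := (hW.indepFun_bridge hτ).measure_inter_preimage_eq_mul _ _ hTm (hφ hS)
  have h2 : {ω | (∀ s ≤ τ, ‖W s ω - ((s : ℝ) / τ) • W τ ω‖ ≤ ε) ∧
      (W τ ω, fun t ↦ W (τ + t) ω - W τ ω) ∈ S} =
      (fun ω (s : Set.Iic τ) ↦ W s ω - ((s : ℝ) / τ) • W τ ω) ⁻¹' T ∩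
        (fun ω (t : Set.Ici τ) ↦ W t ω) ⁻¹' (φ ⁻¹' S) := by
    ext ω
    rw [Set.mem_inter_iff, Set.mem_preimage, hTω]
    rfl
  rw [h2, h1]
  -- If `‖W s‖ ≤ ε / 2` up to time `τ`, the path and the subtracted segment each contribute at most
  -- `ε / 2` to the bridge.
  refine mul_ne_zero (fun h0 ↦ hP (measure_mono_null (fun ω hω ↦ ?_) h0)) hPS
  refine (hTω ω).2 fun s hs ↦ ?_
  have hle : (s : ℝ) / τ ≤ 1 := div_le_one_of_le₀ (by exact_mod_cast hs) τ.2
  calc ‖W s ω - ((s : ℝ) / τ) • W τ ω‖ ≤ ‖W s ω‖ + ‖((s : ℝ) / τ) • W τ ω‖ := norm_sub_le _ _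
    _ ≤ ε / 2 + 1 * (ε / 2) := by
      rw [norm_smul, Real.norm_of_nonneg (by positivity)]
      exact add_le_add (hω s hs) (mul_le_mul hle (hω τ le_rfl) (norm_nonneg _) zero_le_one)
    _ = ε := by ring

end IsContinuousBM

/-- If a ball inside `U` contains survival points in positive measure, then all points of the
ball are survival points. -/
lemma ball_subset_survivalSet {U : Set (EuclideanSpace ℝ (Fin d))} (hU : IsOpen U)
    {z : EuclideanSpace ℝ (Fin d)} {ε : ℝ} (hε : 0 < ε) (hz : Metric.ball z (3 * ε) ⊆ U)
    (hvol : volume (survivalSet P U ∩ Metric.ball z ε) ≠ 0) :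
    Metric.ball z ε ⊆ survivalSet P U := by
  intro x hx W hW
  obtain ⟨τ, hτ, h⟩ := hW.exists_bridge hε
  set S : Set (EuclideanSpace ℝ (Fin d) × (ℝ≥0 → EuclideanSpace ℝ (Fin d))) :=
    {p | x + p.1 ∈ Metric.ball z ε ∧ (fun t ↦ x + p.1 + p.2 t) ∈ pathsStayingIn U} with hS
  have hSm : MeasurableSet S := by
    have h1 : Measurable fun p : EuclideanSpace ℝ (Fin d) × (ℝ≥0 → EuclideanSpace ℝ (Fin d)) ↦
        x + p.1 := measurable_fst.const_add x
    have h2 : Measurable fun p : EuclideanSpace ℝ (Fin d) × (ℝ≥0 → EuclideanSpace ℝ (Fin d)) ↦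
        fun t ↦ x + p.1 + p.2 t :=
      measurable_pi_lambda _ fun t ↦ h1.add ((measurable_pi_apply t).comp measurable_snd)
    exact (h1 measurableSet_ball).inter (h2 (measurableSet_pathsStayingIn U))
  have hPS : P {ω | (W τ ω, fun t ↦ W (τ + t) ω - W τ ω) ∈ S} ≠ 0 := by
    rw [hW.measure_markov τ hSm]
    intro h0
    rw [lintegral_eq_zero_iff (hW.measurable_measure_shift τ hSm)] at h0
    -- The law of `W τ` has a positive density, so a null set for it is Lebesgue null; translation
    -- by `x` then contradicts `hvol`. Since `survivalSet` quantifies over every Brownian motion on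
    -- `P`, it applies to the increments after `τ`.
    have h1 := (hW.volume_absolutelyContinuous hτ).ae_le h0
    have h2 : ∀ᵐ v, P {ω | (-x + v, fun t ↦ W (τ + t) ω - W τ ω) ∈ S} = 0 :=
      (measurePreserving_add_left volume (-x)).quasiMeasurePreserving.ae h1
    refine hvol (measure_mono_null ?_ (ae_iff.1 h2))
    rintro v ⟨hv, hvz⟩
    refine (lt_of_lt_of_le (hv _ (hW.shift τ)) (measure_mono fun ω hω ↦ ?_)).ne'
    have hc := (hW.shift τ).cont ω
    refine ⟨by simpa using hvz, ?_⟩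
    rw [mem_pathsStayingIn_iff hU (by fun_prop)]
    simpa using hω
  refine (pos_iff_ne_zero.2 (h S hSm hPS)).trans_le (measure_mono fun ω hω t ↦ ?_)
  obtain ⟨hb, hend, hstay⟩ := hω
  have hc := (hW.shift τ).cont ω
  rw [mem_pathsStayingIn_iff hU (by fun_prop)] at hstay
  rcases le_total t τ with ht | ht
  · refine hz ?_
    have hbt := hb t ht
    dsimp only at hend
    rw [Metric.mem_ball, dist_eq_norm] at hend hx ⊢
    set θ : ℝ := (t : ℝ) / τ with hθ
    have hθ0 : 0 ≤ θ := by positivity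
    have hθ1 : θ ≤ 1 := div_le_one_of_le₀ (by exact_mod_cast ht) τ.2
    -- Up to time `τ` the path is a convex combination of two points within `ε` of `z`, plus a
    -- bridge of norm at most `ε`; hence the radius `3 * ε`.
    have heq : x + W t ω - z =
        (1 - θ) • (x - z) + θ • (x + W τ ω - z) + (W t ω - θ • W τ ω) := by module
    rw [heq]
    calc _ ≤ (1 - θ) * ‖x - z‖ + θ * ‖x + W τ ω - z‖ + ‖W t ω - θ • W τ ω‖ := by
          refine (norm_add_le _ _).trans (add_le_add_left ((norm_add_le _ _).trans ?_) _)
          rw [norm_smul, norm_smul, Real.norm_of_nonneg hθ0, Real.norm_of_nonneg (by linarith)]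
      _ ≤ (1 - θ) * ε + θ * ε + ε := by
          have : 0 ≤ 1 - θ := by linarith
          gcongr
      _ < 3 * ε := by linarith
  · have := hstay (t - τ)
    simpa [add_tsub_cancel_of_le ht] using this

/-- In a region, if the survival points have positive measure, then every point is a survival
point. -/
lemma subset_survivalSet {U : Set (EuclideanSpace ℝ (Fin d))} (hU : IsOpen U)
    (hconn : IsPreconnected U) {A : Set (EuclideanSpace ℝ (Fin d))} (hAU : A ⊆ U)
    (hA : A ⊆ survivalSet P U) (hvol : volume A ≠ 0) : U ⊆ survivalSet P U := by
  have key : ∀ z ∈ U, (∀ ε > 0, volume (survivalSet P U ∩ Metric.ball z ε) ≠ 0) →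
      z ∈ interior (survivalSet P U) := by
    intro z hz h
    obtain ⟨δ, hδ, hball⟩ := Metric.isOpen_iff.1 hU z hz
    have hδ3 : 0 < δ / 3 := by positivity
    refine mem_interior.2 ⟨_, ball_subset_survivalSet hU hδ3 ?_ (h _ hδ3), Metric.isOpen_ball,
      Metric.mem_ball_self hδ3⟩
    rwa [mul_div_cancel₀ δ three_ne_zero]
  refine (hconn.subset_of_closure_inter_subset isOpen_interior ?_ ?_).trans interior_subset
  -- A set of positive measure has a point all of whose neighbourhoods meet it in positive measure.
  · obtain ⟨z, hzA, hz⟩ := exists_mem_forall_mem_nhdsWithin_pos_measure hvol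
    refine ⟨z, hAU hzA, key z (hAU hzA) fun ε hε ↦ ?_⟩
    have := hz (A ∩ Metric.ball z ε)
      (Filter.inter_mem self_mem_nhdsWithin (mem_nhdsWithin_of_mem_nhds (Metric.ball_mem_nhds z hε)))
    exact (this.trans_le (measure_mono (Set.inter_subset_inter_left _ hA))).ne'
  · rintro z ⟨hz, hzU⟩
    refine key z hzU fun ε hε ↦ ?_
    obtain ⟨y, hy, hyz⟩ := Metric.mem_closure_iff.1 hz ε hε
    have hopen : IsOpen (interior (survivalSet P U) ∩ Metric.ball z ε) :=
      isOpen_interior.inter Metric.isOpen_ball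
    have := hopen.measure_pos volume ⟨y, hy, by rwa [Metric.mem_ball, dist_comm]⟩
    exact (this.trans_le (measure_mono (Set.inter_subset_inter_left _ interior_subset))).ne'

end

/-! ### The hitting bound and its average at large times -/

lemma greenTail_zero_lt_top {d : ℕ} (hd : 3 ≤ d) {ρ : ℝ} (hρ : 0 < ρ) : greenTail d 0 ρ < ⊤ := by
  rw [greenTail_zero_scale (by lia) hρ]
  exact ENNReal.mul_lt_top ENNReal.ofReal_lt_top (greenTail_zero_one_lt_top hd)

lemma greenTail_zero_ne_zero {d : ℕ} (hd : 3 ≤ d) {ρ : ℝ} (hρ : 0 < ρ) : greenTail d 0 ρ ≠ 0 := by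
  rw [greenTail_zero_scale (by lia) hρ]
  exact mul_ne_zero (ENNReal.ofReal_pos.2 (by positivity)).ne' (greenTail_zero_one_pos d)

lemma greenTail_zero_div {d : ℕ} (hd : 3 ≤ d) {ρ σ : ℝ} (hρ : 0 < ρ) (hσ : 0 < σ) :
    greenTail d 0 ρ / greenTail d 0 σ = ENNReal.ofReal ((σ / ρ) ^ (d - 2)) := by
  symm
  rw [ENNReal.eq_div_iff (greenTail_zero_ne_zero hd hσ) (greenTail_zero_lt_top hd hσ).ne, mul_comm,
    greenTail_zero_scale (by lia) hρ, greenTail_zero_scale (by lia) hσ, ← mul_assoc,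
    ← ENNReal.ofReal_mul (by positivity), ← mul_pow]
  congr 3
  field_simp

lemma lintegral_heatKernel (d : ℕ) {t : ℝ≥0} (ht : 0 < t) :
    ∫⁻ y : EuclideanSpace ℝ (Fin d), heatKernel d t ‖y‖ = 1 := by
  have h : IsProbabilityMeasure
      ((Measure.pi fun _ : Fin d ↦ gaussianReal 0 t).map
        (WithLp.toLp 2 : (Fin d → ℝ) → EuclideanSpace ℝ (Fin d))) :=
    Measure.isProbabilityMeasure_map (by fun_prop)
  rw [map_pi_gaussianReal d ht] at h
  have := h.measure_univ
  rwa [withDensity_apply _ .univ, setLIntegral_univ] at this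

/-- The integral of a function over `(n, ∞)` is small for large `n` if it is finite over
`(0, ∞)`. -/
lemma exists_setLIntegral_Ioi_lt_one {F : ℝ → ENNReal} (h : ∫⁻ s in Set.Ioi 0, F s ≠ ⊤) :
    ∃ n : ℕ, ∫⁻ s in Set.Ioi ((n : ℝ) + 1), F s < 1 := by
  have hanti : Antitone fun n : ℕ ↦ Set.Ioi ((n : ℝ) + 1) := fun a b hab ↦
    Set.Ioi_subset_Ioi (by simpa using hab)
  have hsub : ∀ n : ℕ, Set.Ioi ((n : ℝ) + 1) ⊆ Set.Ioi 0 := fun n ↦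
    Set.Ioi_subset_Ioi (by positivity)
  have hempty : ⋂ n : ℕ, Set.Ioi ((n : ℝ) + 1) = ∅ := by
    refine Set.eq_empty_of_forall_notMem fun x hx ↦ ?_
    obtain ⟨n, hn⟩ := exists_nat_gt x
    have := Set.mem_iInter.1 hx n
    rw [Set.mem_Ioi] at this
    linarith
  have hfin : (volume.withDensity F) (Set.Ioi (((0 : ℕ) : ℝ) + 1)) ≠ ⊤ := by
    rw [withDensity_apply _ measurableSet_Ioi]
    exact ((lintegral_mono_set (hsub 0)).trans_lt h.lt_top).ne
  have hlim := tendsto_measure_iInter_atTop (μ := volume.withDensity F)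
    (fun n ↦ measurableSet_Ioi.nullMeasurableSet) hanti ⟨0, hfin⟩
  rw [hempty, measure_empty] at hlim
  obtain ⟨n, hn⟩ := (hlim.eventually (gt_mem_nhds zero_lt_one)).exists
  refine ⟨n, ?_⟩
  rwa [Function.comp_apply, withDensity_apply _ measurableSet_Ioi] at hn

section

variable {d : ℕ} {Ω ι : Type*} [MeasurableSpace Ω] {P : Measure Ω}
  {c : ι → EuclideanSpace ℝ (Fin d)} {r : ι → ℝ}

/-- A superharmonic function that bounds the probability of hitting one of the balls. -/
noncomputable def hittingBound (c : ι → EuclideanSpace ℝ (Fin d)) (r : ι → ℝ)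
    (x : EuclideanSpace ℝ (Fin d)) : ENNReal :=
  ∑' n, greenTail d 0 ‖x - c n‖ / greenTail d 0 (2 * r n)

/-- Union bound. Doubling the radius puts each closed ball inside an open one, to which
`measure_hit_mul_le` applies. -/
lemma measure_hit_balls_le [Countable ι] (hd : 3 ≤ d) (hr : ∀ n, 0 < r n)
    {W : ℝ≥0 → Ω → EuclideanSpace ℝ (Fin d)} (hW : IsContinuousBM W P)
    (x : EuclideanSpace ℝ (Fin d)) :
    P {ω | ∀ t, x + W t ω ∈ ballsComplement c r}ᶜ ≤ hittingBound c r x := by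
  have h1 : {ω | ∀ t, x + W t ω ∈ ballsComplement c r}ᶜ ⊆
      ⋃ n, {ω | ∃ t, ‖x - c n + W t ω‖ < 2 * r n} := by
    intro ω hω
    simp only [Set.mem_compl_iff, Set.mem_ofPred_eq, not_forall, ballsComplement, not_not,
      Set.mem_iUnion, mem_closedBall_iff_norm] at hω ⊢
    obtain ⟨t, n, h⟩ := hω
    refine ⟨n, t, ?_⟩
    rw [sub_add_eq_add_sub]
    linarith [hr n]
  refine (measure_mono h1).trans ((measure_iUnion_le _).trans (ENNReal.tsum_le_tsum fun n ↦ ?_))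
  have h2 : 0 < 2 * r n := by linarith [hr n]
  rw [ENNReal.le_div_iff_mul_le (.inl (greenTail_zero_ne_zero hd h2))
    (.inl (greenTail_zero_lt_top hd h2).ne)]
  exact hW.measure_hit_mul_le _ _

lemma mem_survivalSet_of_hittingBound_lt_one [Countable ι] (hd : 3 ≤ d) (hr : ∀ n, 0 < r n)
    {x : EuclideanSpace ℝ (Fin d)} (hx : hittingBound c r x < 1) :
    x ∈ survivalSet P (ballsComplement c r) := by
  intro W hW
  have := hW.isProbabilityMeasure
  by_contra! h0
  -- Subadditivity needs no measurability of the survival event.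
  have h1 : P Set.univ ≤ 0 + hittingBound c r x := by
    rw [← Set.union_compl_self {ω | ∀ t, x + W t ω ∈ ballsComplement c r}]
    exact (measure_union_le _ _).trans (add_le_add h0 (measure_hit_balls_le hd hr hW x))
  rw [measure_univ, zero_add] at h1
  exact absurd hx h1.not_gt

lemma mem_ballsComplement_of_hittingBound_lt_one (hd : 3 ≤ d) (hr : ∀ n, 0 < r n)
    {x : EuclideanSpace ℝ (Fin d)} (hx : hittingBound c r x < 1) : x ∈ ballsComplement c r := by
  by_contra h
  simp only [ballsComplement, Set.mem_compl_iff, not_not, Set.mem_iUnion,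
    mem_closedBall_iff_norm] at h
  obtain ⟨n, hn⟩ := h
  have h2 : 0 < 2 * r n := by linarith [hr n]
  have h3 : greenTail d 0 (2 * r n) ≤ greenTail d 0 ‖x - c n‖ :=
    greenTail_anti d le_rfl (norm_nonneg _) (by linarith)
  have h4 : 1 ≤ greenTail d 0 ‖x - c n‖ / greenTail d 0 (2 * r n) := by
    rwa [ENNReal.le_div_iff_mul_le (.inl (greenTail_zero_ne_zero hd h2))
      (.inl (greenTail_zero_lt_top hd h2).ne), one_mul]
  exact absurd hx (h4.trans (ENNReal.le_tsum n)).not_gt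

/-- By scaling, the terms are those of `hsum` times `2 ^ (d - 2)`, the cost of doubling the radii.
-/
lemma hittingBound_zero_ne_top (hd : 3 ≤ d) (hr : ∀ n, 0 < r n)
    (h0 : (0 : EuclideanSpace ℝ (Fin d)) ∈ ballsComplement c r)
    (hsum : Summable (fun n ↦ (r n / ‖c n‖) ^ (d - 2))) : hittingBound c r 0 ≠ ⊤ := by
  have hc : ∀ n, 0 < ‖c n‖ := fun n ↦ by
    refine norm_pos_iff.2 fun h ↦ h0 (Set.mem_iUnion.2 ⟨n, ?_⟩)
    simpa [h] using (hr n).le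
  have h1 : hittingBound c r 0 = ∑' n, ENNReal.ofReal ((2 * r n / ‖c n‖) ^ (d - 2)) :=
    tsum_congr fun n ↦ by
      rw [zero_sub, norm_neg, greenTail_zero_div hd (hc n) (by linarith [hr n])]
  rw [h1]
  refine Summable.tsum_ofReal_ne_top ((hsum.mul_left (2 ^ (d - 2))).congr fun n ↦ ?_)
  rw [mul_div_assoc, mul_pow]

lemma lintegral_hittingBound [Countable ι] {t : ℝ} (ht : 0 < t) :
    ∫⁻ y : EuclideanSpace ℝ (Fin d), hittingBound c r y * heatKernel d t ‖y‖ =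
      ∫⁻ s in Set.Ioi t, ∑' n, heatKernel d s ‖c n‖ / greenTail d 0 (2 * r n) := by
  have hk : ∀ n, Measurable fun s ↦ heatKernel d s ‖c n‖ := fun n ↦
    (measurable_heatKernel d).comp (measurable_id.prodMk measurable_const)
  have hg : ∀ n, Measurable fun y : EuclideanSpace ℝ (Fin d) ↦ greenTail d 0 ‖y - c n‖ := fun n ↦
    (measurable_greenTail d 0).comp (measurable_id.sub_const (c n)).norm
  simp_rw [hittingBound, ← ENNReal.tsum_mul_right]
  have hgk : ∀ n, Measurable fun y : EuclideanSpace ℝ (Fin d) ↦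
      greenTail d 0 ‖y - c n‖ * heatKernel d t ‖y‖ := fun n ↦
    (hg n).mul (measurable_heatKernel_norm d t)
  simp_rw [div_eq_mul_inv, mul_right_comm _ _ (heatKernel d t _)]
  rw [lintegral_tsum fun n ↦ ((hgk n).mul_const _).aemeasurable,
    lintegral_tsum fun n ↦ ((hk n).mul_const _).aemeasurable]
  refine tsum_congr fun n ↦ ?_
  rw [lintegral_mul_const _ (hgk n),
    lintegral_mul_const _ (hk n)]
  congr 1
  have := lintegral_greenTail_mul_heatKernel d ht (-c n)
  simp_rw [neg_add_eq_sub, norm_neg] at this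
  exact this

/-- Were the bound at least `1` almost everywhere, its heat-kernel average would be at least `1` at
every positive time; but that average is the tail of a convergent integral. -/
lemma volume_hittingBound_lt_one_ne_zero [Countable ι] (h : hittingBound c r 0 ≠ ⊤) :
    volume {y | hittingBound c r y < 1} ≠ 0 := by
  have hk : ∀ n, Measurable fun s ↦ heatKernel d s ‖c n‖ := fun n ↦
    (measurable_heatKernel d).comp (measurable_id.prodMk measurable_const)
  have hF : ∫⁻ s in Set.Ioi (0 : ℝ), ∑' n, heatKernel d s ‖c n‖ / greenTail d 0 (2 * r n) =
      hittingBound c r 0 := by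
    rw [lintegral_tsum fun n ↦ ((hk n).div_const _).aemeasurable]
    refine tsum_congr fun n ↦ ?_
    simp_rw [div_eq_mul_inv]
    rw [lintegral_mul_const _ (hk n), zero_sub, norm_neg]
    rfl
  obtain ⟨n, hn⟩ := exists_setLIntegral_Ioi_lt_one (hF ▸ h)
  -- The added `1` keeps the time positive when `n = 0`, as the Gaussian density requires.
  have ht : (0 : ℝ≥0) < (n : ℝ≥0) + 1 := by positivity
  rw [← lintegral_hittingBound (by positivity)] at hn
  intro h0
  have h1 : ∀ᵐ y, 1 ≤ hittingBound c r y := by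
    rw [ae_iff]
    simpa using h0
  refine absurd hn (not_lt.2 ?_)
  rw [← lintegral_heatKernel d ht]
  refine lintegral_mono_ae (h1.mono fun y hy ↦ ?_)
  push_cast
  exact le_mul_of_one_le_left' hy

end

theorem proposition1 {d : ℕ} (hd : 3 ≤ d) {ι : Type*} [Countable ι]
    (c : ι → EuclideanSpace ℝ (Fin d)) (r : ι → ℝ) (hr : ∀ n, 0 < r n)
    (hdisj : ∀ m n, m ≠ n → Disjoint (Metric.ball (c m) (r m)) (Metric.ball (c n) (r n)))
    (hregion : IsRegion (ballsComplement c r))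
    (h0 : (0 : EuclideanSpace ℝ (Fin d)) ∈ ballsComplement c r)
    (hsum : Summable (fun n ↦ (r n / ‖c n‖) ^ (d - 2)))
    {Ω : Type*} [MeasurableSpace Ω] (P : Measure Ω)
    (B : ℝ≥0 → Ω → EuclideanSpace ℝ (Fin d)) (hB : IsBrownianMotion B P) :
    IsAvoidableFor B P c r := by
  obtain ⟨W, hW, hBW⟩ := hB.exists_isContinuousBM
  have hmem : (0 : EuclideanSpace ℝ (Fin d)) ∈ survivalSet P (ballsComplement c r) :=
    subset_survivalSet hregion.1 hregion.2.isPreconnected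
      (fun y hy ↦ mem_ballsComplement_of_hittingBound_lt_one hd hr hy)
      (fun y hy ↦ mem_survivalSet_of_hittingBound_lt_one hd hr hy)
      (volume_hittingBound_lt_one_ne_zero (hittingBound_zero_ne_top hd hr h0 hsum)) h0
  refine (hmem W hW).trans_le (measure_mono_ae ?_)
  filter_upwards [hBW] with ω hω hmemω t n
  have := hmemω t
  rw [zero_add, ← hω t] at this
  exact fun hn ↦ this (Set.mem_iUnion.2 ⟨n, hn⟩)
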